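/- Let $\mathbb K$ be a field of characteristic $0$. A (locally finite) root system in a $\mathbb K$-vector space $E$ is a spanning subset $R\subseteq E$ with $0\in R$, with $R\cap F$ finite for every finite-dimensional subspace $F\subseteq E$, and such that for every $\alpha\in R^\times:=R\setminus\{0\}$ there is a (unique) coroot $\alpha^\vee\in E^*$ with $\langle\alpha,\alpha^\vee\rangle=2$ and $s_\alpha(R)=R$, where $s_\alpha(x)=x-\langle x,\alpha^\vee\rangle\alpha$, and $\langle\beta,\alpha^\vee\rangle\in\mathbb Z$ for all $\alpha,\beta\in R$ (with $0^\vee=0$). $R$ is reduced if $\mathbb Z\alpha\cap R\subseteq\{-\alpha,0,\alpha\}$ for all $\alpha\in R$, and irreducible if any two nonzero roots $\alpha,\beta$ can be joined by roots $\beta_1,\dots,\beta_m$ ($m\ge 1$) with $\langle\alpha,\beta_1^\vee\rangle\ne0$, $\langle\beta_i,\beta_{i+1}^\vee\rangle\neq0$ for $1\le i<m$, and $\langle\beta,\beta_m^\vee\rangle\neq0$. Let $\mathcal Q(R)$ be the subgroup of $E$ generated by $R$. For $0\ne\gamma\in\mathcal Q(R)$ the divisor $n_\gamma$ is the greatest positive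 integer $n$ with $\langle\gamma,\alpha^\vee\rangle\in n\mathbb Z$ for all $\alpha\in R$. A degenerate sum is an element $\gamma\in\mathcal Q(R)$ which is a sum of two linearly independent roots and has $n_\gamma>1$. $R$ is of type $C$ if, for some nonempty (possibly infinite) set $I$, it is isomorphic to $C_I=\{0\}\cup\{\pm\varepsilon_i\pm\varepsilon_j: i\ne j\}\cup\{\pm2\varepsilon_i\}\subseteq\mathbb K^{(I)}$ (so $A_1=C_1$ and $B_2=C_2$ are of type $C$). Let $R$ be an irreducible reduced root system and $k$ a commutative unital ring, with $2$ invertible in $k$ if $R$ is of type $C$. Let $L$ be an $R$-graded Lie algebra over $k$, i.e. a $\mathcal Q(R)$-graded Lie algebra $L=\bigoplus_{\gamma\in\mathcal Q(R)}L_\gamma$ such that $L_\gamma=0$ for $\gamma\notin R$; for every $\alpha\in R^\times$ there are $e_\alpha\in L_\alpha$ and $f_\alpha\in L_{-\alpha}$ such that $h_\alpha=[f_\alpha,e_\alpha]$ acts on $L_\beta$ as multiplication by $\langle\beta,\alpha^\vee\rangle$ for all $\beta\in R$; and $L_0=\sum_{\alpha\in R^\times}[L_\alpha,L_{-\alpha}]$.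 Let $f:K\to L$ be a $\mathcal Q(R)$-graded central covering, i.e. $K$ is a perfect $\mathcal Q(R)$-graded Lie algebra over $k$ and $f$ is a surjective Lie algebra homomorphism with $f(K_\gamma)\subseteq L_\gamma$ for all $\gamma$ and with kernel contained in the centre of $K$. Then for every $0\neq\gamma\in\mathcal Q(R)$ with $K_\gamma\neq0$, either (i) $\gamma\in R$ and $f$ restricts to a bijection $K_\gamma\to L_\gamma$; or (ii) $\gamma\notin R$, $\gamma$ is a degenerate sum, $K_\gamma\subseteq\ker f$, $n_\gamma\in\{2,3\}$, and $n_\gamma K_\gamma=0$. -/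

import Mathlib

universe u v w

/-- A (locally finite) root system in a vector space `E` over a field `𝕂` (of characteristic zero
in all uses).  Zero is a root, and `coroot 0 = 0`.  The coroot of a nonzero root is uniquely
determined by these conditions; the value of `coroot` at vectors which are not roots carries no
information. -/
structure LocallyFiniteRootSystem (𝕂 : Type u) (E : Type v) [Field 𝕂] [AddCommGroup E]
    [Module 𝕂 E] where
  /-- the set `R` of roots, including `0` -/
  roots : Set E
  /-- `coroot α x` is `⟨x, α∨⟩` -/
  coroot : E → Module.Dual 𝕂 E
  zero_mem : (0 : E) ∈ roots
  span_roots : Submodule.span 𝕂 roots = ⊤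
  locallyFinite : ∀ F : Submodule 𝕂 E, FiniteDimensional 𝕂 F → (roots ∩ (F : Set E)).Finite
  coroot_zero : coroot 0 = 0
  coroot_self : ∀ α ∈ roots, α ≠ 0 → coroot α α = 2
  reflection_image : ∀ α ∈ roots, α ≠ 0 → (fun x : E => x - coroot α x • α) '' roots = roots
  integral : ∀ α ∈ roots, ∀ β ∈ roots, ∃ m : ℤ, coroot α β = (m : 𝕂)

namespace LocallyFiniteRootSystem

variable {𝕂 : Type u} {E : Type v} [Field 𝕂] [AddCommGroup E] [Module 𝕂 E]

/-- The root lattice `Q(R)`. -/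
def rootLattice (R : LocallyFiniteRootSystem 𝕂 E) : AddSubgroup E :=
  AddSubgroup.closure R.roots

theorem exists_int_coroot (R : LocallyFiniteRootSystem 𝕂 E) (γ : R.rootLattice) (α : R.roots) :
    ∃ m : ℤ, R.coroot (α : E) (γ : E) = (m : 𝕂) := by
  obtain ⟨γ, hγ⟩ := γ
  induction hγ using AddSubgroup.closure_induction with
  | mem x hx => exact R.integral α α.2 x hx
  | zero => exact ⟨0, by simp⟩
  | add x y _ _ hx hy =>
    obtain ⟨m, hm⟩ := hx
    obtain ⟨n, hn⟩ := hy
    exact ⟨m + n, by simp at hm hn; simp [hm, hn]⟩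
  | neg x _ hx =>
    obtain ⟨m, hm⟩ := hx
    exact ⟨-m, by simp at hm; simp [hm]⟩

/-- The integer `⟨γ, α∨⟩` for `γ` in the root lattice and a root `α`. -/
noncomputable def pairing (R : LocallyFiniteRootSystem 𝕂 E) (γ : R.rootLattice) (α : R.roots) : ℤ :=
  (R.exists_int_coroot γ α).choose

theorem pairing_spec (R : LocallyFiniteRootSystem 𝕂 E) (γ : R.rootLattice) (α : R.roots) :
    R.coroot (α : E) (γ : E) = (R.pairing γ α : 𝕂) :=
  (R.exists_int_coroot γ α).choose_spec

/-- `R` is reduced: `ℤα ∩ R ⊆ {-α, 0, α}` for every root `α`. -/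
def IsReduced (R : LocallyFiniteRootSystem 𝕂 E) : Prop :=
  ∀ α ∈ R.roots, ∀ n : ℤ, n • α ∈ R.roots → n • α = -α ∨ n • α = 0 ∨ n • α = α

/-- One step of a connecting chain: `α`, `β` are roots and `⟨α, β∨⟩ ≠ 0`. -/
def Linked (R : LocallyFiniteRootSystem 𝕂 E) (α β : E) : Prop :=
  α ∈ R.roots ∧ β ∈ R.roots ∧ R.coroot β α ≠ 0

/-- There is a chain of roots `β₁, …, β_k` (`k ≥ 1`) with `⟨α, β₁∨⟩ ≠ 0`, `⟨β_i, β_{i+1}∨⟩ ≠ 0`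
and `⟨β, β_k∨⟩ ≠ 0`. -/
def Connected (R : LocallyFiniteRootSystem 𝕂 E) (α β : E) : Prop :=
  ∃ δ : E, Relation.TransGen R.Linked α δ ∧ R.Linked β δ

/-- `R` is irreducible: any two nonzero roots are connected. -/
def IsIrreducible (R : LocallyFiniteRootSystem 𝕂 E) : Prop :=
  ∀ α ∈ R.roots, α ≠ 0 → ∀ β ∈ R.roots, β ≠ 0 → R.Connected α β

/-- The roots of the standard root system `C_I` in `𝕂^(I)`: zero, `±ε_i ± ε_j` for `i ≠ j`, and
`±2ε_i`. -/
def typeCRoots (𝕂 : Type u) [Field 𝕂] (I : Type w) : Set (I →₀ 𝕂) :=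
  {0} ∪
  {x | ∃ i j : I, i ≠ j ∧ ∃ s t : ℤˣ,
    x = Finsupp.single i ((s : ℤ) : 𝕂) + Finsupp.single j ((t : ℤ) : 𝕂)} ∪
  {x | ∃ i : I, ∃ s : ℤˣ, x = Finsupp.single i (2 * ((s : ℤ) : 𝕂))}

/-- `R` is isomorphic to `C_I` for some nonempty set `I` (so `A₁ = C₁` and `B₂ = C₂` are included).
An index set for a basis of `E` may be taken in the universe of `E`. -/
def IsTypeC (R : LocallyFiniteRootSystem 𝕂 E) : Prop :=
  ∃ (I : Type v) (_ : Nonempty I) (e : E ≃ₗ[𝕂] (I →₀ 𝕂)), e '' R.roots = typeCRoots 𝕂 I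

/-- The divisor `n_γ` of a nonzero `γ` in the root lattice: the greatest positive integer `n` with
`⟨γ, R∨⟩ ⊆ nℤ`. -/
noncomputable def divisor (R : LocallyFiniteRootSystem 𝕂 E) (γ : R.rootLattice) : ℕ :=
  sSup {n : ℕ | 0 < n ∧ ∀ α : R.roots, (n : ℤ) ∣ R.pairing γ α}

/-- `γ` is a degenerate sum: a sum of two linearly independent roots, of divisor greater
than `1`. -/
def IsDegenerateSum (R : LocallyFiniteRootSystem 𝕂 E) (γ : R.rootLattice) : Prop :=
  (∃ α ∈ R.roots, ∃ β ∈ R.roots, LinearIndependent 𝕂 ![α, β] ∧ (γ : E) = α + β) ∧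
    1 < R.divisor γ

end LocallyFiniteRootSystem

/-- The `Q(R)`-graded Lie algebra `L` (with homogeneous spaces `𝓛 γ`) is `R`-graded. -/
structure IsRootGraded {𝕂 : Type*} {E : Type*} [Field 𝕂] [AddCommGroup E] [Module 𝕂 E]
    (R : LocallyFiniteRootSystem 𝕂 E) [DecidableEq R.rootLattice]
    {k : Type*} {L : Type*} [CommRing k] [LieRing L] [LieAlgebra k L]
    (𝓛 : R.rootLattice → Submodule k L) [GradedLieAlgebra 𝓛] : Prop where
  /-- the support is contained in `R` -/
  eq_bot_of_notMem : ∀ γ : R.rootLattice, (γ : E) ∉ R.roots → 𝓛 γ = ⊥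
  /-- for every nonzero root `α` there are `e ∈ L_α`, `f ∈ L_{-α}` such that `h = [f, e]` acts on
  each `L_β` by `⟨β, α∨⟩` -/
  exists_invertible : ∀ α : R.rootLattice, ∀ hα : (α : E) ∈ R.roots, α ≠ 0 →
    ∃ e ∈ 𝓛 α, ∃ f ∈ 𝓛 (-α), ∀ β : R.rootLattice, (β : E) ∈ R.roots →
      ∀ x ∈ 𝓛 β, ⁅⁅f, e⁆, x⁆ = R.pairing β ⟨(α : E), hα⟩ • x
  /-- `L_0 = ∑ [L_α, L_{-α}]`, the sum being over the nonzero roots -/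
  zero_eq : 𝓛 0 = Submodule.span k
    {z | ∃ α : R.rootLattice, (α : E) ∈ R.roots ∧ α ≠ 0 ∧
      ∃ x ∈ 𝓛 α, ∃ y ∈ 𝓛 (-α), z = ⁅x, y⁆}

/-- `f : K → L` is a central covering: a central extension of `L` with `K` perfect. -/
structure IsCentralCovering {k : Type*} {K : Type*} {L : Type*} [CommRing k]
    [LieRing K] [LieAlgebra k K] [LieRing L] [LieAlgebra k L] (f : K →ₗ⁅k⁆ L) : Prop where
  surjective : Function.Surjective f
  ker_le_center : f.ker ≤ LieAlgebra.center k K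
  perfect : ⁅(⊤ : LieIdeal k K), (⊤ : LieIdeal k K)⁆ = ⊤

namespace LocallyFiniteRootSystem

/-! ### Pairings of two roots, reduced to finite root systems of rank at most two. -/

section RankTwo

variable {𝕂 : Type u} {E : Type v} [Field 𝕂] [AddCommGroup E] [Module 𝕂 E]
  (R : LocallyFiniteRootSystem 𝕂 E)

/-! Since `ker f` is central, the elements `h_α` lift to `K` and act on every `K_γ`, root degree or
not, as the integer `⟨γ, α∨⟩` (`exists_lift`). Central elements are killed by this action, so all
pairings of `γ`, and hence `n_γ`, annihilate `K_γ ∩ ker f` (`pairing_smul_eq_zero`,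
`divisor_smul_eq_zero`).

If `γ` is a root, the kernel in degree `γ` is killed by `⟨γ, γ∨⟩ = 2`. It vanishes as soon as some
pairing of `γ` is odd; if none is, then `R` is of type `C` (`isTypeC_of_mem_evenRoots`) and `2` is
invertible.

If `γ` is not a root, `K_γ` lies in the kernel and, `K` being perfect, is spanned by brackets `[K_β,
K_δ]` of root degrees with `β + δ = γ`. When `γ` is a sum of two independent roots, rank-two
arithmetic gives `n_γ ≤ 3`, and `n_γ = 1` would force `K_γ = 0`. Otherwise `γ = 2β`, and a Jacobi
computation (`odd_pairing_smul_lie`) shows that the odd pairings of `β` kill `[K_β, K_β]`, as `⟨2β,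
β∨⟩ = 4` does; so `K_γ = 0` by the same dichotomy. -/

theorem reflection_mem {α x : E} (hα : α ∈ R.roots) (hα0 : α ≠ 0) (hx : x ∈ R.roots) :
    x - R.coroot α x • α ∈ R.roots := by
  rw [← R.reflection_image α hα hα0]
  exact ⟨x, hx, rfl⟩

theorem neg_mem {α : E} (hα : α ∈ R.roots) : -α ∈ R.roots := by
  by_cases hα0 : α = 0
  · simpa [hα0] using R.zero_mem
  · have := R.reflection_mem hα hα0 hα
    rw [R.coroot_self α hα hα0] at this
    convert this using 1
    module

/-- The nonzero roots in a subspace. -/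
def rootsIn (F : Submodule 𝕂 E) : Set F := {x | (x : E) ∈ R.roots ∧ x ≠ 0}

/-- The restriction to `F` of the coroot of a nonzero root in `F`. -/
def corootIn (F : Submodule 𝕂 E) (x : R.rootsIn F) : Module.Dual 𝕂 F :=
  (R.coroot (x : F)).comp F.subtype

theorem finite_rootsIn (F : Submodule 𝕂 E) [FiniteDimensional 𝕂 F] : (R.rootsIn F).Finite := by
  refine Set.Finite.of_finite_image (f := F.subtype) ((R.locallyFinite F ‹_›).subset ?_)
    F.injective_subtype.injOn
  rintro _ ⟨x, hx, rfl⟩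
  exact ⟨hx.1, x.2⟩

theorem corootIn_self (F : Submodule 𝕂 E) (x : R.rootsIn F) : R.corootIn F x x = 2 :=
  R.coroot_self _ x.2.1 (by simpa using x.2.2)

theorem mapsTo_preReflection_rootsIn [CharZero 𝕂] (F : Submodule 𝕂 E) (x : R.rootsIn F) :
    Set.MapsTo (Module.preReflection (x : F) (R.corootIn F x)) (R.rootsIn F) (R.rootsIn F) := by
  intro y hy
  refine ⟨?_, fun h => hy.2 ?_⟩
  · simpa [Module.preReflection_apply, corootIn] using
      R.reflection_mem x.2.1 (by simpa using x.2.2) hy.1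
  · have := Module.involutive_preReflection (R.corootIn_self F x) y
    rw [h, map_zero] at this
    exact this.symm

/-- If `x` and `y` share a coroot, iterating `s_x s_y` sends `y` to `y + 2n(x - y)`; finiteness of
the root set forces `x = y`. -/
theorem injective_corootIn [CharZero 𝕂] (F : Submodule 𝕂 E) [FiniteDimensional 𝕂 F] :
    Function.Injective (R.corootIn F) := by
  intro x y h
  have : IsAddTorsionFree F := .of_isTorsionFree 𝕂 F
  exact Subtype.ext <| Module.eq_of_mapsTo_reflection_of_mem (R.finite_rootsIn F)
    (R.corootIn_self F x) (R.corootIn_self F y) (h ▸ R.corootIn_self F x)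
    (h ▸ R.corootIn_self F y) (R.mapsTo_preReflection_rootsIn F x)
    (R.mapsTo_preReflection_rootsIn F y) y.2

/-- The finite root system formed by the nonzero roots in a finite-dimensional subspace spanned by
roots. -/
noncomputable def rootPairingIn [CharZero 𝕂] (F : Submodule 𝕂 E) [FiniteDimensional 𝕂 F]
    (hF : Submodule.span 𝕂 (R.rootsIn F) = ⊤) :
    RootPairing (R.rootsIn F) 𝕂 F (Module.Dual 𝕂 F) :=
  haveI : Finite (R.rootsIn F) := R.finite_rootsIn F
  RootPairing.mk'' (Module.Dual.eval 𝕂 F) (Function.Embedding.subtype _)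
    ⟨R.corootIn F, R.injective_corootIn F⟩ (R.corootIn_self F)
    (fun x => by
      have h : (Module.Dual.eval 𝕂 F).flip (R.corootIn F x) = R.corootIn F x := rfl
      simpa [h] using R.mapsTo_preReflection_rootsIn F x) (by simpa using hF)

theorem isCrystallographic_rootPairingIn [CharZero 𝕂] (F : Submodule 𝕂 E) [FiniteDimensional 𝕂 F]
    (hF : Submodule.span 𝕂 (R.rootsIn F) = ⊤) : (R.rootPairingIn F hF).IsCrystallographic := by
  refine ⟨fun x y => ?_⟩
  obtain ⟨m, hm⟩ := R.integral _ y.2.1 _ x.2.1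
  exact ⟨m, hm.symm⟩

/-- The possible values of the pairings of two nonzero roots. -/
theorem coroot_mul_coroot [CharZero 𝕂] {α β : E} (hα : α ∈ R.roots) (hα0 : α ≠ 0)
    (hβ : β ∈ R.roots) (hβ0 : β ≠ 0) {p q : ℤ} (hp : R.coroot α β = p) (hq : R.coroot β α = q) :
    (p * q = 0 ∨ p * q = 1 ∨ p * q = 2 ∨ p * q = 3 ∨ p * q = 4) ∧ (p = 0 ↔ q = 0) ∧
      (LinearIndependent 𝕂 ![α, β] → p * q ≠ 4) := by
  -- Local finiteness makes the roots in this span a finite crystallographic root system, to which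
  -- the classical bounds on the Coxeter weight `p * q` apply.
  set F := Submodule.span 𝕂 (Set.range ![α, β]) with hFdef
  have hαF : α ∈ F := Submodule.subset_span ⟨0, rfl⟩
  have hβF : β ∈ F := Submodule.subset_span ⟨1, rfl⟩
  let a : R.rootsIn F := ⟨⟨α, hαF⟩, hα, by simpa using hα0⟩
  let b : R.rootsIn F := ⟨⟨β, hβF⟩, hβ, by simpa using hβ0⟩
  have : FiniteDimensional 𝕂 F := FiniteDimensional.span_of_finite 𝕂 (Set.finite_range _)
  have : Finite (R.rootsIn F) := R.finite_rootsIn F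
  have hF : Submodule.span 𝕂 (R.rootsIn F) = ⊤ := by
    apply Submodule.map_injective_of_injective F.injective_subtype
    rw [Submodule.map_top, Submodule.range_subtype, Submodule.map_span]
    refine le_antisymm (Submodule.span_le.2 ?_) (Submodule.span_mono ?_)
    · rintro _ ⟨x, -, rfl⟩
      exact x.2
    · rintro _ ⟨i, rfl⟩
      fin_cases i
      exacts [⟨a, a.2, rfl⟩, ⟨b, b.2, rfl⟩]
  set P := R.rootPairingIn F hF
  have : P.IsCrystallographic := R.isCrystallographic_rootPairingIn F hF
  have hab : P.pairing a b = q := hq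
  have hba : P.pairing b a = p := hp
  refine ⟨?_, ?_, ?_⟩
  · have h := P.coxeterWeightIn_mem_set_of_isCrystallographic b a
    have h' : P.coxeterWeightIn ℤ b a = p * q := by
      have := P.algebraMap_coxeterWeightIn ℤ b a
      rw [RootPairing.coxeterWeight, hab, hba, eq_intCast] at this
      exact_mod_cast this
    rw [h'] at h
    simpa using h
  · have := P.pairing_eq_zero_iff (i := b) (j := a)
    rw [hab, hba] at this
    exact_mod_cast this
  · intro hli h4
    have hli' : LinearIndependent 𝕂 ![P.root a, P.root b] := by
      refine LinearIndependent.of_comp F.subtype ?_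
      convert hli using 1
      ext i
      fin_cases i <;> rfl
    have : IsAddTorsionFree F := .of_isTorsionFree 𝕂 F
    refine RootPairing.coxeterWeight_ne_four_of_linearIndependent P hli' ?_
    rw [RootPairing.coxeterWeight, hab, hba, mul_comm]
    exact_mod_cast h4

theorem coroot_eq_zero_iff [CharZero 𝕂] {α β : E} (hα : α ∈ R.roots) (hβ : β ∈ R.roots) :
    R.coroot α β = 0 ↔ R.coroot β α = 0 := by
  by_cases hα0 : α = 0
  · simp [hα0, R.coroot_zero]
  by_cases hβ0 : β = 0
  · simp [hβ0, R.coroot_zero]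
  obtain ⟨p, hp⟩ := R.integral α hα β hβ
  obtain ⟨q, hq⟩ := R.integral β hβ α hα
  have := (R.coroot_mul_coroot hα hα0 hβ hβ0 hp hq).2.1
  rw [hp, hq]
  exact_mod_cast this

/-- Proportional nonzero roots of a reduced root system are equal or opposite. -/
theorem IsReduced.eq_or_eq_neg [CharZero 𝕂] {R : LocallyFiniteRootSystem 𝕂 E} (hred : R.IsReduced)
    {α β : E} (hα : α ∈ R.roots) (hα0 : α ≠ 0) (hβ : β ∈ R.roots) (hβ0 : β ≠ 0)
    (h : ¬ LinearIndependent 𝕂 ![α, β]) : β = α ∨ β = -α := by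
  have key : ∀ {α : E}, α ∈ R.roots → α ≠ 0 → ∀ n : ℤ, n • α ∈ R.roots →
      n = -1 ∨ n = 0 ∨ n = 1 := by
    intro α hα hα0 n hn
    have : IsAddTorsionFree E := .of_isTorsionFree 𝕂 E
    have hinj := smul_left_injective ℤ hα0
    rcases hred α hα n hn with h | h | h
    · exact .inl (hinj (by simpa using h))
    · exact .inr (.inl (hinj (by simpa using h)))
    · exact .inr (.inr (hinj (by simpa using h)))
  rw [LinearIndependent.pair_iff' hα0] at h
  push Not at h
  obtain ⟨c, rfl⟩ := h
  obtain ⟨p, hp⟩ := R.integral α hα _ hβ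
  obtain ⟨q, hq⟩ := R.integral _ hβ α hα
  have hp2 : c * 2 = p := by
    rw [← hp, map_smul, R.coroot_self α hα hα0, smul_eq_mul]
  have hq2 : c * q = 2 := by
    rw [← hq, ← R.coroot_self _ hβ hβ0, map_smul, smul_eq_mul]
  have hpq : p * q = 4 := by
    have : (p : 𝕂) * q = 4 := by rw [← hp2]; linear_combination 2 * hq2
    exact_mod_cast this
  have hpd : p ∣ 4 := ⟨q, hpq.symm⟩
  have hple : p ≤ 4 := Int.le_of_dvd (by norm_num) hpd
  have hpge : -4 ≤ p := by
    have := Int.le_of_dvd (by norm_num) ((neg_dvd).2 hpd)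
    omega
  have hα' : ∀ n : ℤ, c * n = 1 → n = -1 ∨ n = 0 ∨ n = 1 := by
    intro n hn
    refine key hβ hβ0 n ?_
    rw [← Int.cast_smul_eq_zsmul 𝕂, smul_smul, mul_comm, hn, one_smul]
    exact hα
  have hβ' : ∀ n : ℤ, c = n → n = -1 ∨ n = 0 ∨ n = 1 := by
    intro n hn
    refine key hα hα0 n ?_
    rw [← Int.cast_smul_eq_zsmul 𝕂, ← hn]
    exact hβ
  have hc : c = p / 2 := by field_simp; exact hp2
  -- Here `β = cα` with `p = 2c` a divisor of `4`. The values `c = ±2` and `c = ±1/2` contradict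
  -- reducedness at `α` and at `β` respectively.
  interval_cases p <;> try omega
  · have := hβ' (-2) (by rw [hc]; norm_num)
    omega
  · right
    rw [hc]
    norm_num
  · have := hα' (-2) (by rw [hc]; norm_num)
    omega
  · have := hα' 2 (by rw [hc]; norm_num)
    omega
  · left
    rw [hc]
    norm_num
  · have := hβ' 2 (by rw [hc]; norm_num)
    omega

end RankTwo

end LocallyFiniteRootSystem

namespace LocallyFiniteRootSystem

/-! ### Recognition of type `C`: even roots are the future `±2ε_i`. -/

section TypeC

variable {𝕂 : Type u} {E : Type v} [Field 𝕂] [AddCommGroup E] [Module 𝕂 E]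

/-- The nonzero roots all of whose pairings with coroots are even. -/
def evenRoots (R : LocallyFiniteRootSystem 𝕂 E) : Set E :=
  {σ | σ ∈ R.roots ∧ σ ≠ 0 ∧ ∀ α ∈ R.roots, ∃ m : ℤ, R.coroot α σ = 2 * m}

variable {R : LocallyFiniteRootSystem 𝕂 E} {α β σ τ ρ : E}

theorem neg_mem_evenRoots (hσ : σ ∈ R.evenRoots) : -σ ∈ R.evenRoots := by
  refine ⟨R.neg_mem hσ.1, neg_ne_zero.2 hσ.2.1, fun α hα => ?_⟩
  obtain ⟨m, hm⟩ := hσ.2.2 α hα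
  exact ⟨-m, by rw [map_neg, hm]; push_cast; ring⟩

theorem reflection_mem_evenRoots (hσ : σ ∈ R.evenRoots) (hα : α ∈ R.roots) (hα0 : α ≠ 0) :
    σ - R.coroot α σ • α ∈ R.evenRoots := by
  refine ⟨R.reflection_mem hα hα0 hσ.1, fun h => hσ.2.1 ?_, fun β hβ => ?_⟩
  · have h' := congrArg (R.coroot α) h
    rw [map_sub, map_smul, R.coroot_self α hα hα0, map_zero, smul_eq_mul] at h'
    have h0 : R.coroot α σ = 0 := by linear_combination -h'
    simpa [h0] using h
  · obtain ⟨m, hm⟩ := hσ.2.2 β hβ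
    obtain ⟨n, hn⟩ := hσ.2.2 α hα
    obtain ⟨l, hl⟩ := R.integral β hβ α hα
    refine ⟨m - n * l, ?_⟩
    rw [map_sub, map_smul, hm, hn, hl, smul_eq_mul]
    push_cast
    ring

theorem units_smul_mem_evenRoots (s : ℤˣ) (hσ : σ ∈ R.evenRoots) :
    ((s : ℤ) : 𝕂) • σ ∈ R.evenRoots := by
  rcases Int.units_eq_one_or s with rfl | rfl
  · simpa using hσ
  · simpa using neg_mem_evenRoots hσ

/-- If two roots are linked, then an even root linked to the first gives one linked to both. -/
theorem exists_evenRoot_of_linked (hσ : σ ∈ R.evenRoots) (hα : α ∈ R.roots)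
    (hne : R.coroot α σ ≠ 0) (hβα : R.coroot β α ≠ 0) :
    ∃ τ ∈ R.evenRoots, R.coroot α τ ≠ 0 ∧ R.coroot β τ ≠ 0 := by
  -- If `σ` is orthogonal to `β`, its reflection in `α` pairs with `β∨` as `-⟨σ, α∨⟩⟨α, β∨⟩`, which
  -- is nonzero.
  by_cases h : R.coroot β σ = 0
  · have hα0 : α ≠ 0 := by
      rintro rfl
      simp [R.coroot_zero] at hne
    refine ⟨_, reflection_mem_evenRoots hσ hα hα0, ?_, ?_⟩
    · rw [map_sub, map_smul, R.coroot_self α hα hα0, smul_eq_mul]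
      intro h
      exact hne (by linear_combination -h)
    · rw [map_sub, map_smul, h, zero_sub, smul_eq_mul]
      exact neg_ne_zero.2 (mul_ne_zero hne hβα)
  · exact ⟨σ, hσ, hne, h⟩

theorem exists_evenRoot_of_transGen (hσ : σ ∈ R.evenRoots)
    (h : Relation.TransGen R.Linked σ β) : ∃ τ ∈ R.evenRoots, R.coroot β τ ≠ 0 := by
  induction h with
  | single h => exact ⟨σ, hσ, h.2.2⟩
  | tail _ h ih =>
    obtain ⟨τ, hτ, hne⟩ := ih
    obtain ⟨τ', hτ', -, hne'⟩ := exists_evenRoot_of_linked hτ h.1 hne h.2.2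
    exact ⟨τ', hτ', hne'⟩

/-- Two even roots are joined if they are proportional or half their sum is a root. -/
def Joined (R : LocallyFiniteRootSystem 𝕂 E) (σ τ : E) : Prop :=
  τ = σ ∨ τ = -σ ∨ ∃ α ∈ R.roots, (2 : 𝕂) • α = σ + τ

theorem Joined.symm (h : R.Joined σ τ) : R.Joined τ σ := by
  rcases h with rfl | rfl | ⟨α, hα, h⟩
  · exact .inl rfl
  · exact .inr (.inl (neg_neg _).symm)
  · exact .inr (.inr ⟨α, hα, by rw [h, add_comm]⟩)

variable [CharZero 𝕂]

/-- Both pairings are even, so their product is a multiple of `4`; for independent roots it is at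
most `3`, hence zero. -/
theorem coroot_evenRoots (hred : R.IsReduced) (hσ : σ ∈ R.evenRoots) (hτ : τ ∈ R.evenRoots)
    (h : τ ≠ σ) (h' : τ ≠ -σ) : R.coroot σ τ = 0 := by
  obtain ⟨p, hp⟩ := hτ.2.2 σ hσ.1
  obtain ⟨q, hq⟩ := hσ.2.2 τ hτ.1
  have hli : LinearIndependent 𝕂 ![σ, τ] := by
    by_contra hli
    rcases hred.eq_or_eq_neg hσ.1 hσ.2.1 hτ.1 hτ.2.1 hli with h'' | h'' <;> contradiction
  obtain ⟨h1, h2, h3⟩ := R.coroot_mul_coroot hσ.1 hσ.2.1 hτ.1 hτ.2.1 (p := 2 * p) (q := 2 * q)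
    (by rw [hp]; push_cast; rfl) (by rw [hq]; push_cast; rfl)
  have h3 := h3 hli
  have h4 : 2 * p * (2 * q) = 4 * (p * q) := by ring
  rw [h4] at h1 h3
  have h5 : p * q = 0 := by omega
  have h6 : p = 0 := by
    rcases mul_eq_zero.1 h5 with h | h
    · exact h
    · subst h
      simpa using h2
  simp [hp, h6]

/-- The two pairings of an even root with a root which is neither orthogonal nor proportional
to it. -/
theorem pairings_evenRoot (hred : R.IsReduced) (hσ : σ ∈ R.evenRoots) (hα : α ∈ R.roots)
    (h : α ≠ σ) (h' : α ≠ -σ) (hne : R.coroot α σ ≠ 0) :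
    (R.coroot α σ = 2 ∧ R.coroot σ α = 1) ∨ (R.coroot α σ = -2 ∧ R.coroot σ α = -1) := by
  have hα0 : α ≠ 0 := by
    rintro rfl
    simp [R.coroot_zero] at hne
  obtain ⟨m, hm⟩ := hσ.2.2 α hα
  obtain ⟨q, hq⟩ := R.integral σ hσ.1 α hα
  have hli : LinearIndependent 𝕂 ![σ, α] := by
    by_contra hli
    rcases hred.eq_or_eq_neg hσ.1 hσ.2.1 hα hα0 hli with h'' | h'' <;> contradiction
  obtain ⟨h1, h2, h3⟩ := R.coroot_mul_coroot hσ.1 hσ.2.1 hα hα0 (q := 2 * m) hq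
    (by rw [hm]; push_cast; rfl)
  have h3 := h3 hli
  have hm0 : m ≠ 0 := by
    rintro rfl
    simp [hm] at hne
  have hq0 : q ≠ 0 := fun h => hm0 (by have := h2.1 h; omega)
  have h4 : q * (2 * m) = 2 * (q * m) := by ring
  have h5 : q * m ≠ 0 := mul_ne_zero hq0 hm0
  rw [h4] at h1 h3
  have h6 : q * m = 1 := by omega
  rcases Int.eq_one_or_neg_one_of_mul_eq_one' h6 with ⟨rfl, rfl⟩ | ⟨rfl, rfl⟩
  · exact .inl ⟨by simp [hm], by simp [hq]⟩
  · exact .inr ⟨by simp [hm], by simp [hq]⟩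

/-- A root which is not even is half the sum of two even roots, the first of which may be
prescribed up to sign. -/
theorem exists_two_smul_eq_add (hred : R.IsReduced) (hσ : σ ∈ R.evenRoots) (hα : α ∈ R.roots)
    (hαS : α ∉ R.evenRoots) (hne : R.coroot α σ ≠ 0) :
    ∃ ρ ∈ R.evenRoots, (ρ = σ ∨ ρ = -σ) ∧ ∃ τ ∈ R.evenRoots, τ ≠ ρ ∧ τ ≠ -ρ ∧
      (2 : 𝕂) • α = ρ + τ := by
  have hα0 : α ≠ 0 := by
    rintro rfl
    simp [R.coroot_zero] at hne
  obtain ⟨ρ, hρ, hρσ, τ, hτ, h⟩ : ∃ ρ ∈ R.evenRoots, (ρ = σ ∨ ρ = -σ) ∧ ∃ τ ∈ R.evenRoots,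
      (2 : 𝕂) • α = ρ + τ := by
    -- As `⟨σ, α∨⟩ = ±2`, the reflection of `σ` in `α` is the even root `σ ∓ 2α`, so `2α` is up to
    -- sign the difference of two even roots.
    have hs := reflection_mem_evenRoots hσ hα hα0
    rcases pairings_evenRoot hred hσ hα (fun h => hαS (h ▸ hσ))
      (fun h => hαS (h ▸ neg_mem_evenRoots hσ)) hne with ⟨h, -⟩ | ⟨h, -⟩
    · rw [h] at hs
      exact ⟨σ, hσ, .inl rfl, _, neg_mem_evenRoots hs, by module⟩
    · rw [h] at hs
      exact ⟨-σ, neg_mem_evenRoots hσ, .inr rfl, _, hs, by module⟩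
  refine ⟨ρ, hρ, hρσ, τ, hτ, ?_, ?_, h⟩
  · rintro rfl
    rw [← two_smul 𝕂] at h
    exact hαS (smul_right_injective E two_ne_zero h ▸ hρ)
  · rintro rfl
    rw [add_neg_cancel] at h
    simp [hα0] at h

theorem exists_evenRoot_coroot_ne_zero (hirr : R.IsIrreducible) (hσ : σ ∈ R.evenRoots)
    (hα : α ∈ R.roots) (hα0 : α ≠ 0) : ∃ τ ∈ R.evenRoots, R.coroot α τ ≠ 0 := by
  obtain ⟨δ, h1, h2⟩ := hirr σ hσ.1 hσ.2.1 α hα hα0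
  obtain ⟨τ, hτ, hne⟩ := exists_evenRoot_of_transGen hσ h1
  obtain ⟨τ', hτ', -, hne'⟩ := exists_evenRoot_of_linked hτ h2.2.1 hne
    (fun h => h2.2.2 ((R.coroot_eq_zero_iff hα h2.2.1).1 h))
  exact ⟨τ', hτ', hne'⟩

theorem coroot_half_sum (hred : R.IsReduced) (hσ : σ ∈ R.evenRoots) (hτ : τ ∈ R.evenRoots)
    (h : τ ≠ σ) (h' : τ ≠ -σ) (hα : (2 : 𝕂) • α = σ + τ) : R.coroot σ α = 1 := by
  have h1 := congrArg (R.coroot σ) hα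
  rw [map_add, coroot_evenRoots hred hσ hτ h h', R.coroot_self σ hσ.1 hσ.2.1, map_smul,
    smul_eq_mul, add_zero] at h1
  exact mul_left_cancel₀ two_ne_zero (h1.trans (mul_one 2).symm)

/-- Reflecting the half sum in `τ` changes the sign of `τ` only. -/
theorem Joined.neg_right (hred : R.IsReduced) (hσ : σ ∈ R.evenRoots) (hτ : τ ∈ R.evenRoots)
    (h : R.Joined σ τ) : R.Joined σ (-τ) := by
  by_cases h1 : τ = σ
  · exact .inr (.inl (by rw [h1]))
  by_cases h2 : τ = -σ
  · exact .inl (by rw [h2, neg_neg])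
  obtain ⟨α, hα, h⟩ := (h.resolve_left h1).resolve_left h2
  refine .inr (.inr ⟨_, R.reflection_mem hτ.1 hτ.2.1 hα, ?_⟩)
  rw [coroot_half_sum hred hτ hσ (Ne.symm h1) (fun h => h2 (by rw [h, neg_neg]))
    (h.trans (add_comm _ _)), smul_sub, h]
  module

theorem Joined.of_neg_right (hred : R.IsReduced) (hσ : σ ∈ R.evenRoots) (hτ : τ ∈ R.evenRoots)
    (h : R.Joined σ (-τ)) : R.Joined σ τ := by
  simpa using h.neg_right hred hσ (neg_mem_evenRoots hτ)

/-- In the generic case the model is `σ, τ, ρ = 2ε₁, 2ε₂, 2ε₃`: reflecting `α = ε₁ + ε₂` in `β = ε₂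
+ ε₃` gives `ε₁ - ε₃`, which joins `σ` to `-ρ`. -/
theorem Joined.trans (hred : R.IsReduced) (hσ : σ ∈ R.evenRoots) (hτ : τ ∈ R.evenRoots)
    (hρ : ρ ∈ R.evenRoots) (h : R.Joined σ τ) (h' : R.Joined τ ρ) : R.Joined σ ρ := by
  by_cases h1 : τ = σ
  · rwa [← h1]
  by_cases h2 : τ = -σ
  · rw [h2] at h'
    exact (h'.symm.of_neg_right hred hρ hσ).symm
  by_cases h3 : ρ = τ
  · rwa [h3]
  by_cases h4 : ρ = -τ
  · rw [h4]
    exact h.neg_right hred hσ hτ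
  by_cases h5 : ρ = σ
  · exact .inl h5
  by_cases h6 : ρ = -σ
  · exact .inr (.inl h6)
  obtain ⟨α, hα, hα2⟩ := (h.resolve_left h1).resolve_left h2
  obtain ⟨β, hβ, hβ2⟩ := (h'.resolve_left h3).resolve_left h4
  have hβ0 : β ≠ 0 := by
    rintro rfl
    rw [smul_zero] at hβ2
    exact h4 (eq_neg_of_add_eq_zero_right hβ2.symm)
  have hτβ := coroot_half_sum hred hτ hρ h3 h4 hβ2
  have hβτ : R.coroot β τ = 2 := by
    rcases pairings_evenRoot hred hτ hβ
        (by rintro rfl; rw [R.coroot_self β hβ hβ0] at hτβ; norm_num at hτβ)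
        (by rintro rfl; rw [map_neg, R.coroot_self τ hτ.1 hτ.2.1] at hτβ; norm_num at hτβ)
        (fun h => by rw [← R.coroot_eq_zero_iff hτ.1 hβ, hτβ] at h; exact one_ne_zero h)
      with h | h
    · exact h.1
    · rw [h.2] at hτβ
      norm_num at hτβ
  have hσβ : R.coroot σ β = 0 := by
    have h7 := congrArg (R.coroot σ) hβ2
    rw [map_add, coroot_evenRoots hred hσ hτ h1 h2, coroot_evenRoots hred hσ hρ h5 h6, map_smul,
      smul_eq_mul, add_zero] at h7
    exact (mul_eq_zero.1 h7).resolve_left two_ne_zero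
  have hβα : R.coroot β α = 1 := by
    have h7 := congrArg (R.coroot β) hα2
    rw [map_add, hβτ, (R.coroot_eq_zero_iff hσ.1 hβ).1 hσβ, map_smul, smul_eq_mul, zero_add] at h7
    exact mul_left_cancel₀ two_ne_zero (h7.trans (mul_one 2).symm)
  refine Joined.of_neg_right hred hσ hρ (.inr (.inr ⟨_, R.reflection_mem hβ hβ0 hα, ?_⟩))
  rw [hβα, one_smul, smul_sub, hα2, hβ2]
  abel

/-- For `τ ≠ ±σ` the root `α` is not even, so `2α = ±σ + ρ'` with `ρ'` even. Since `τ` is orthogonal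
to `σ` but not to `α`, it is not orthogonal to `ρ'`, whence `ρ' = ±τ`. -/
theorem joined_of_coroot_ne_zero (hred : R.IsReduced) (hσ : σ ∈ R.evenRoots)
    (hτ : τ ∈ R.evenRoots) (hα : α ∈ R.roots) (h : R.coroot α σ ≠ 0) (h' : R.coroot α τ ≠ 0) :
    R.Joined σ τ := by
  by_cases hτσ : τ = σ
  · exact .inl hτσ
  by_cases hτσ' : τ = -σ
  · exact .inr (.inl hτσ')
  have hαS : α ∉ R.evenRoots := by
    intro hαS
    have h1 : σ = α ∨ σ = -α := by
      by_contra hn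
      exact h (coroot_evenRoots hred hαS hσ (fun h => hn (.inl h)) (fun h => hn (.inr h)))
    have h2 : τ = α ∨ τ = -α := by
      by_contra hn
      exact h' (coroot_evenRoots hred hαS hτ (fun h => hn (.inl h)) (fun h => hn (.inr h)))
    rcases h1 with rfl | rfl <;> rcases h2 with rfl | rfl <;> simp at hτσ hτσ'
  obtain ⟨ρ, hρ, hρσ, ρ', hρ', -, -, h2⟩ := exists_two_smul_eq_add hred hσ hα hαS h
  have hτρ : R.coroot τ ρ = 0 := by
    rcases hρσ with rfl | rfl
    · exact coroot_evenRoots hred hτ hσ (Ne.symm hτσ) (fun h => hτσ' (by rw [h, neg_neg]))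
    · rw [map_neg, coroot_evenRoots hred hτ hσ (Ne.symm hτσ)
        (fun h => hτσ' (by rw [h, neg_neg])), neg_zero]
  have hj : R.Joined ρ ρ' := .inr (.inr ⟨α, hα, h2⟩)
  have hρτ : ρ' = τ ∨ ρ' = -τ := by
    by_contra hn
    have h3 := congrArg (R.coroot τ) h2
    rw [map_add, hτρ, coroot_evenRoots hred hτ hρ' (fun h => hn (.inl h))
      (fun h => hn (.inr h)), map_smul, smul_eq_mul, add_zero] at h3
    exact h' ((R.coroot_eq_zero_iff hτ.1 hα).1 ((mul_eq_zero.1 h3).resolve_left two_ne_zero))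
  have hj' : R.Joined ρ τ := by
    rcases hρτ with rfl | rfl
    · exact hj
    · exact hj.of_neg_right hred hρ hτ
  rcases hρσ with rfl | rfl
  · exact hj'
  · exact (hj'.symm.of_neg_right hred hτ hσ).symm

theorem joined_of_transGen (hred : R.IsReduced) (hσ : σ ∈ R.evenRoots)
    (h : Relation.TransGen R.Linked σ β) :
    ∀ τ ∈ R.evenRoots, R.coroot β τ ≠ 0 → R.Joined σ τ := by
  induction h with
  | single h => exact fun τ hτ hne => joined_of_coroot_ne_zero hred hσ hτ h.2.1 h.2.2 hne
  | tail h0 h ih =>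
    intro τ hτ hne
    obtain ⟨ρ, hρ, hne'⟩ := exists_evenRoot_of_transGen hσ h0
    obtain ⟨ρ', hρ', h1, h2⟩ := exists_evenRoot_of_linked hρ h.1 hne' h.2.2
    exact (ih ρ' hρ' h1).trans hred hσ hρ' hτ (joined_of_coroot_ne_zero hred hρ' hτ h.2.1 h2 hne)

theorem joined_evenRoots (hred : R.IsReduced) (hirr : R.IsIrreducible) (hσ : σ ∈ R.evenRoots)
    (hτ : τ ∈ R.evenRoots) : R.Joined σ τ := by
  obtain ⟨δ, h1, h2⟩ := hirr σ hσ.1 hσ.2.1 τ hτ.1 hτ.2.1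
  exact joined_of_transGen hred hσ h1 τ hτ h2.2.2

/-- An irreducible reduced root system with a root all of whose pairings are even is of type
`C`. -/
theorem isTypeC_of_mem_evenRoots (hred : R.IsReduced) (hirr : R.IsIrreducible)
    (hσ : σ ∈ R.evenRoots) : R.IsTypeC := by
  -- The halves of even roots should be the `±ε_i`; a maximal independent set `T` of them picks one
  -- from each pair.
  obtain ⟨T, hTS, hspan, hli⟩ := exists_linearIndependent 𝕂 {x : E | (2 : 𝕂) • x ∈ R.evenRoots}
  have two : (2 : 𝕂) ≠ 0 := two_ne_zero
  have half : ∀ x : E, (2 : 𝕂) • (2 : 𝕂)⁻¹ • x = x := fun x => smul_inv_smul₀ two x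
  have decomp : ∀ α ∈ R.roots, α ≠ 0 → α ∉ R.evenRoots → ∃ x y : E, (2 : 𝕂) • x ∈ R.evenRoots ∧
      (2 : 𝕂) • y ∈ R.evenRoots ∧ y ≠ x ∧ y ≠ -x ∧ α = x + y := by
    intro α hα hα0 hαS
    obtain ⟨τ, hτ, hne⟩ := exists_evenRoot_coroot_ne_zero hirr hσ hα hα0
    obtain ⟨ρ, hρ, -, ρ', hρ', h1, h2, h3⟩ := exists_two_smul_eq_add hred hτ hα hαS hne
    refine ⟨(2 : 𝕂)⁻¹ • ρ, (2 : 𝕂)⁻¹ • ρ', by rwa [half], by rwa [half], fun h => h1 ?_,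
      fun h => h2 ?_, ?_⟩
    · exact smul_right_injective E (inv_ne_zero two) h
    · rw [← smul_neg] at h
      exact smul_right_injective E (inv_ne_zero two) h
    · rw [← smul_add, ← h3, inv_smul_smul₀ two]
  have htop : ⊤ ≤ Submodule.span 𝕂 (Set.range ((↑) : T → E)) := by
    rw [Subtype.range_coe, hspan, ← R.span_roots, Submodule.span_le]
    intro α hα
    by_cases hα0 : α = 0
    · rw [hα0]
      exact Submodule.zero_mem _
    by_cases hαS : α ∈ R.evenRoots
    · rw [← half α]
      exact Submodule.smul_mem _ _ (Submodule.subset_span (by simpa only [Set.mem_ofPred_eq, half]))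
    · obtain ⟨x, y, hx, hy, -, -, rfl⟩ := decomp α hα hα0 hαS
      exact Submodule.add_mem _ (Submodule.subset_span hx) (Submodule.subset_span hy)
  have unit_smul : ∀ x : E, (2 : 𝕂) • x ∈ R.evenRoots →
      ∃ i : T, ∃ s : ℤˣ, x = ((s : ℤ) : 𝕂) • (i : E) := by
    intro x hx
    by_contra hn
    push Not at hn
    -- A half `x` outside `±T` would be orthogonal to all of `T`, which spans `E`; but `2x` pairs to
    -- `2` with its own coroot.
    have hker : Submodule.span 𝕂 (Set.range ((↑) : T → E)) ≤
        LinearMap.ker (R.coroot ((2 : 𝕂) • x)) := by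
      rw [Submodule.span_le]
      rintro _ ⟨i, rfl⟩
      have h0 := coroot_evenRoots hred hx (hTS i.2)
        (fun h => hn i 1 (by simpa using (smul_right_injective E two h).symm))
        (fun h => hn i (-1) (by
          rw [← smul_neg] at h
          have := smul_right_injective E two h
          simp [this]))
      rw [map_smul, smul_eq_mul] at h0
      exact (mul_eq_zero.1 h0).resolve_left two
    have h0 : R.coroot ((2 : 𝕂) • x) ((2 : 𝕂) • x) = 0 := hker (htop Submodule.mem_top)
    rw [R.coroot_self _ hx.1 hx.2.1] at h0
    exact two h0
  let b := Module.Basis.mk hli htop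
  have hb : ∀ i : T, b.repr (i : E) = Finsupp.single i 1 := fun i => by
    rw [← Module.Basis.mk_apply hli htop i]
    exact b.repr_self i
  have hbs : ∀ (i : T) (c : 𝕂), b.repr (c • (i : E)) = Finsupp.single i c := fun i c => by
    rw [map_smul, hb, Finsupp.smul_single, smul_eq_mul, mul_one]
  have hinj : ∀ (i j : T) (s t : ℤˣ), i ≠ j → ((s : ℤ) : 𝕂) • (i : E) ≠ ((t : ℤ) : 𝕂) • (j : E) := by
    intro i j s t hij h
    have h' := DFunLike.congr_fun (congrArg b.repr h) i
    rw [hbs, hbs, Finsupp.single_eq_same, Finsupp.single_eq_of_ne hij] at h'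
    exact s.ne_zero (by exact_mod_cast h')
  obtain ⟨i₀, -⟩ := unit_smul ((2 : 𝕂)⁻¹ • σ) (by rwa [half])
  refine ⟨T, ⟨i₀⟩, b.repr, Set.Subset.antisymm ?_ ?_⟩
  · rintro _ ⟨α, hα, rfl⟩
    by_cases hα0 : α = 0
    · exact .inl (.inl (by simp [hα0]))
    by_cases hαS : α ∈ R.evenRoots
    · obtain ⟨i, s, h⟩ := unit_smul ((2 : 𝕂)⁻¹ • α) (by rwa [half])
      refine .inr ⟨i, s, ?_⟩
      rw [← half α, h, smul_smul, hbs]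
    · obtain ⟨x, y, hx, hy, h1, h2, rfl⟩ := decomp α hα hα0 hαS
      obtain ⟨i, s, rfl⟩ := unit_smul x hx
      obtain ⟨j, t, rfl⟩ := unit_smul y hy
      refine .inl (.inr ⟨i, j, ?_, s, t, by rw [map_add, hbs, hbs]⟩)
      rintro rfl
      rcases Int.units_eq_one_or s with rfl | rfl <;>
        rcases Int.units_eq_one_or t with rfl | rfl <;> simp at h1 h2
  · rintro x ((hx | ⟨i, j, hij, s, t, rfl⟩) | ⟨i, s, rfl⟩)
    · rw [Set.mem_singleton_iff.1 hx]
      exact ⟨0, R.zero_mem, map_zero _⟩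
    · refine ⟨((s : ℤ) : 𝕂) • (i : E) + ((t : ℤ) : 𝕂) • (j : E), ?_, by rw [map_add, hbs, hbs]⟩
      have hi := units_smul_mem_evenRoots s (hTS i.2)
      have hj := units_smul_mem_evenRoots t (hTS j.2)
      rw [smul_comm] at hi hj
      -- Irreducibility enters here: it makes every `±ε_i ± ε_j` a root.
      rcases joined_evenRoots hred hirr hi hj with h | h | ⟨α, hα, h⟩
      · exact absurd (smul_right_injective E two h).symm (hinj i j s t hij)
      · rw [← smul_neg] at h
        have h' := (smul_right_injective E two h).symm
        rw [neg_eq_iff_eq_neg, ← neg_smul] at h'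
        exact absurd (by simpa using h') (hinj i j s (-t) hij)
      · rw [← smul_add] at h
        exact smul_right_injective E two h ▸ hα
    · refine ⟨(2 : 𝕂) • ((s : ℤ) : 𝕂) • (i : E), ?_, by rw [smul_smul, hbs]⟩
      rw [smul_comm]
      exact (units_smul_mem_evenRoots s (hTS i.2)).1

end TypeC

end LocallyFiniteRootSystem

/-! ### Homogeneous components of graded Lie algebras. -/

section GradedLie

variable {ι k L K : Type*} [DecidableEq ι] [CommRing k] [LieRing L]
  [LieAlgebra k L] [LieRing K] [LieAlgebra k K]

/-- The projection onto a homogeneous component. -/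
def gradedProj (𝓚 : ι → Submodule k K) [DirectSum.Decomposition 𝓚] (γ : ι) : K →ₗ[k] K :=
  (𝓚 γ).subtype ∘ₗ DirectSum.component k ι (fun i => 𝓚 i) γ ∘ₗ
    (DirectSum.decomposeLinearEquiv 𝓚).toLinearMap

theorem gradedProj_apply (𝓚 : ι → Submodule k K) [DirectSum.Decomposition 𝓚] (γ : ι) (x : K) :
    gradedProj 𝓚 γ x = DirectSum.decompose 𝓚 x γ := rfl

theorem gradedProj_of_mem (𝓚 : ι → Submodule k K) [DirectSum.Decomposition 𝓚] {γ δ : ι} {x : K}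
    (hx : x ∈ 𝓚 δ) : gradedProj 𝓚 γ x = if δ = γ then x else 0 := by
  rw [gradedProj_apply]
  split_ifs with h
  · subst h
    exact DirectSum.decompose_of_mem_same 𝓚 hx
  · exact DirectSum.decompose_of_mem_ne 𝓚 hx h

variable [AddCommMonoid ι]

/-- In a perfect graded Lie algebra the homogeneous components are spanned by brackets of
homogeneous elements. -/
theorem graded_le_of_bracket_mem (𝓚 : ι → Submodule k K) [GradedLieAlgebra 𝓚]
    (hperf : ⁅(⊤ : LieIdeal k K), (⊤ : LieIdeal k K)⁆ = ⊤) {γ : ι} (M : Submodule k K)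
    (hM : ∀ β δ, β + δ = γ → ∀ x ∈ 𝓚 β, ∀ y ∈ 𝓚 δ, ⁅x, y⁆ ∈ M) : 𝓚 γ ≤ M := by
  have hbr : ∀ x y : K, gradedProj 𝓚 γ ⁅x, y⁆ ∈ M := by
    intro x y
    induction x using DirectSum.Decomposition.inductionOn 𝓚 with
    | zero => simp
    | add x x' hx hx' =>
      rw [add_lie, map_add]
      exact M.add_mem hx hx'
    | @homogeneous β x =>
      induction y using DirectSum.Decomposition.inductionOn 𝓚 with
      | zero => simp
      | add y y' hy hy' =>
        rw [lie_add, map_add]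
        exact M.add_mem hy hy'
      | @homogeneous δ y =>
        rw [gradedProj_of_mem 𝓚 (SetLike.GradedBracket.bracket_mem x.2 y.2)]
        split_ifs with h
        · exact hM β δ h x x.2 y y.2
        · exact M.zero_mem
  have hle : (⊤ : Submodule k K) ≤ M.comap (gradedProj 𝓚 γ) := by
    have h := congrArg LieSubmodule.toSubmodule hperf
    rw [LieSubmodule.lieIdeal_oper_eq_linear_span, LieSubmodule.top_toSubmodule] at h
    rw [← h, Submodule.span_le]
    rintro _ ⟨x, y, rfl⟩
    exact hbr x y
  intro x hx
  have h := hle (Submodule.mem_top (x := x))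
  rwa [Submodule.mem_comap, gradedProj_of_mem 𝓚 hx, if_pos rfl] at h

/-- A surjective graded homomorphism is surjective on homogeneous components. -/
theorem exists_mem_graded_map_eq (𝓛 : ι → Submodule k L) [GradedLieAlgebra 𝓛]
    (𝓚 : ι → Submodule k K) [GradedLieAlgebra 𝓚] {f : K →ₗ⁅k⁆ L}
    (hf : Function.Surjective f) (hgr : ∀ γ, ∀ x ∈ 𝓚 γ, f x ∈ 𝓛 γ) {γ : ι} {y : L}
    (hy : y ∈ 𝓛 γ) : ∃ x ∈ 𝓚 γ, f x = y := by
  obtain ⟨z, rfl⟩ := hf y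
  have key : ∀ z : K, f (gradedProj 𝓚 γ z) = gradedProj 𝓛 γ (f z) := by
    intro z
    induction z using DirectSum.Decomposition.inductionOn 𝓚 with
    | zero => simp
    | add x x' hx hx' => simp only [map_add, hx, hx']
    | @homogeneous β x =>
      rw [gradedProj_of_mem 𝓚 x.2, gradedProj_of_mem 𝓛 (hgr β x x.2)]
      split_ifs
      · rfl
      · exact map_zero f
  refine ⟨gradedProj 𝓚 γ z, (DirectSum.decompose 𝓚 z γ).2, ?_⟩
  rw [key, gradedProj_of_mem 𝓛 hy, if_pos rfl]

end GradedLie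

namespace LocallyFiniteRootSystem

variable {𝕂 : Type u} {E : Type v} [Field 𝕂] [AddCommGroup E] [Module 𝕂 E]

/-! ### Arithmetic of integer pairings and divisors. -/

section Pairing

variable (R : LocallyFiniteRootSystem 𝕂 E)

/-- One nonzero pairing bounds the set of common divisors, so the `sSup` defining `divisor` is
attained rather than taking its default value `0`. -/
theorem divisor_mem {γ : R.rootLattice} {α : R.roots} (h : R.pairing γ α ≠ 0) :
    R.divisor γ ∈ {n : ℕ | 0 < n ∧ ∀ α : R.roots, (n : ℤ) ∣ R.pairing γ α} ∧
      BddAbove {n : ℕ | 0 < n ∧ ∀ α : R.roots, (n : ℤ) ∣ R.pairing γ α} := by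
  have hb : BddAbove {n : ℕ | 0 < n ∧ ∀ α : R.roots, (n : ℤ) ∣ R.pairing γ α} := by
    refine ⟨(R.pairing γ α).natAbs, fun n hn => ?_⟩
    exact Nat.le_of_dvd (Int.natAbs_pos.2 h) (Int.natCast_dvd.1 (hn.2 α))
  exact ⟨Nat.sSup_mem ⟨1, one_pos, fun α => by simp⟩ hb, hb⟩

/-- An element of an abelian group killed by all pairings of `γ` is killed by the divisor. -/
theorem divisor_smul_eq_zero {A : Type*} [AddCommGroup A] {γ : R.rootLattice} {α : R.roots}
    (h : R.pairing γ α ≠ 0) {z : A} (hz : ∀ α : R.roots, R.pairing γ α • z = 0) :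
    R.divisor γ • z = 0 := by
  obtain ⟨⟨hpos, hdvd⟩, hb⟩ := R.divisor_mem h
  rw [← addOrderOf_dvd_iff_nsmul_eq_zero]
  have hd : ∀ α : R.roots, (addOrderOf z : ℤ) ∣ R.pairing γ α := fun α =>
    addOrderOf_dvd_iff_zsmul_eq_zero.2 (hz α)
  have hd0 : addOrderOf z ≠ 0 := fun h0 => h (by
    have := hd α
    rwa [h0, Int.natCast_zero, zero_dvd_iff] at this)
  -- The order of `z` divides every pairing, so its lcm with the divisor is again a common divisor;
  -- by maximality the order divides `n_γ`.
  have hlcm : (addOrderOf z).lcm (R.divisor γ) ≤ R.divisor γ := by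
    refine le_csSup hb ⟨Nat.lcm_pos (Nat.pos_of_ne_zero hd0) hpos, fun α => ?_⟩
    exact Int.natCast_dvd.2 (Nat.lcm_dvd (Int.natCast_dvd.1 (hd α)) (Int.natCast_dvd.1 (hdvd α)))
  rw [← le_antisymm hlcm (Nat.le_of_dvd (Nat.lcm_pos (Nat.pos_of_ne_zero hd0) hpos)
    (Nat.dvd_lcm_right _ _))]
  exact Nat.dvd_lcm_left _ _

variable [CharZero 𝕂]

theorem pairing_eq_of_coroot_eq {γ : R.rootLattice} {α : R.roots} {m : ℤ}
    (h : R.coroot (α : E) (γ : E) = m) : R.pairing γ α = m := by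
  rw [R.pairing_spec] at h
  exact_mod_cast h

theorem pairing_add (γ δ : R.rootLattice) (α : R.roots) :
    R.pairing (γ + δ) α = R.pairing γ α + R.pairing δ α :=
  R.pairing_eq_of_coroot_eq (by
    rw [AddSubgroup.coe_add, map_add, R.pairing_spec, R.pairing_spec, Int.cast_add])

theorem pairing_zero_right (γ : R.rootLattice) (h : (0 : E) ∈ R.roots) :
    R.pairing γ ⟨0, h⟩ = 0 :=
  R.pairing_eq_of_coroot_eq (by simp [R.coroot_zero])

theorem pairing_self {γ : R.rootLattice} (h : (γ : E) ∈ R.roots) (hγ : γ ≠ 0) :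
    R.pairing γ ⟨γ, h⟩ = 2 :=
  R.pairing_eq_of_coroot_eq (by
    rw [R.coroot_self _ h (by simpa using hγ)]
    norm_num)

/-- The divisor of a sum of two linearly independent roots is at most `3`. -/
theorem divisor_of_linearIndependent {γ : R.rootLattice} {α β : E} (hα : α ∈ R.roots)
    (hβ : β ∈ R.roots) (hli : LinearIndependent 𝕂 ![α, β]) (hγ : (γ : E) = α + β) :
    (∃ δ : R.roots, R.pairing γ δ ≠ 0) ∧
      (R.divisor γ = 1 ∨ R.divisor γ = 2 ∨ R.divisor γ = 3) := by
  have hα0 : α ≠ 0 := hli.ne_zero 0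
  have hβ0 : β ≠ 0 := hli.ne_zero 1
  obtain ⟨p, hp⟩ := R.integral α hα β hβ
  obtain ⟨q, hq⟩ := R.integral β hβ α hα
  obtain ⟨h1, h2, h3⟩ := R.coroot_mul_coroot hα hα0 hβ hβ0 hp hq
  have h3 := h3 hli
  have hγα : R.pairing γ ⟨α, hα⟩ = 2 + p := R.pairing_eq_of_coroot_eq (by
    rw [hγ, map_add, R.coroot_self α hα hα0, hp]
    norm_num)
  have hγβ : R.pairing γ ⟨β, hβ⟩ = 2 + q := R.pairing_eq_of_coroot_eq (by
    rw [hγ, map_add, R.coroot_self β hβ hβ0, hq, add_comm]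
    norm_num)
  have hne : ∃ δ : R.roots, R.pairing γ δ ≠ 0 := by
    by_contra hn
    push Not at hn
    have ha := hn ⟨α, hα⟩
    have hb := hn ⟨β, hβ⟩
    rw [hγα] at ha
    rw [hγβ] at hb
    have hp2 : p = -2 := by omega
    have hq2 : q = -2 := by omega
    subst hp2 hq2
    norm_num at h3
  refine ⟨hne, ?_⟩
  obtain ⟨δ, hδ⟩ := hne
  obtain ⟨⟨hpos, hdvd⟩, -⟩ := R.divisor_mem hδ
  have da := hdvd ⟨α, hα⟩
  have db := hdvd ⟨β, hβ⟩
  rw [hγα] at da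
  rw [hγβ] at db
  generalize R.divisor γ = n at *
  have key : n ∣ 2 ∨ n ∣ 3 := by
    -- As `n` divides `2 + p` and `2 + q`, it divides `4 - pq`, which is `3`, `2`, `1` for `pq = 1,
    -- 2, 3`. For `pq = 0` both pairings vanish and `n` divides `2`.
    have hdvdc : (n : ℤ) ∣ p * q - 4 := by
      have h4 : p * q - 4 = (2 + p) * q - 2 * (2 + q) := by ring
      rw [h4]
      exact dvd_sub (da.mul_right _) (db.mul_left _)
    rcases h1 with h | h | h | h | h
    · have hp0 : p = 0 := by
        rcases mul_eq_zero.1 h with h | h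
        · exact h
        · exact h2.2 h
      rw [hp0] at da
      exact .inl (by exact_mod_cast da)
    · have hn : (n : ℤ) ∣ 3 := by simpa [h] using dvd_neg.2 hdvdc
      exact .inr (by exact_mod_cast hn)
    · have hn : (n : ℤ) ∣ 2 := by simpa [h] using dvd_neg.2 hdvdc
      exact .inl (by exact_mod_cast hn)
    · rw [h] at hdvdc
      have hn1 : (n : ℤ) ∣ 1 := by simpa using (dvd_neg.2 hdvdc)
      exact .inl ((Int.natCast_dvd_natCast.1 (by exact_mod_cast hn1) : n ∣ 1).trans (one_dvd 2))
    · exact absurd h h3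
  rcases key with h | h
  · rcases (Nat.dvd_prime Nat.prime_two).1 h with h | h <;> simp [h]
  · rcases (Nat.dvd_prime Nat.prime_three).1 h with h | h <;> simp [h]

/-- An element killed by `4` and by the odd pairings of a nonzero root vanishes, provided that `2`
is invertible in type `C`. -/
theorem eq_zero_of_odd_pairing_smul (hred : R.IsReduced) (hirr : R.IsIrreducible)
    {k A : Type*} [CommRing k] [AddCommGroup A] [Module k A] (htwo : R.IsTypeC → IsUnit (2 : k))
    {β : R.rootLattice} (hβ : (β : E) ∈ R.roots) (hβ0 : β ≠ 0) {z : A} (h4 : (4 : ℤ) • z = 0)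
    (h : ∀ α : R.roots, Odd (R.pairing β α) → R.pairing β α • z = 0) : z = 0 := by
  by_cases hodd : ∃ α : R.roots, Odd (R.pairing β α)
  · obtain ⟨α, hα⟩ := hodd
    have hz := h α hα
    have hcop : IsCoprime (R.pairing β α) 4 := by
      have h2 : IsCoprime (R.pairing β α) 2 := by
        obtain ⟨m, hm⟩ := hα
        exact ⟨1, -m, by rw [hm]; ring⟩
      exact h2.mul_right h2
    obtain ⟨a, b, hab⟩ := hcop
    rw [← one_smul ℤ z, ← hab, add_smul, mul_smul, mul_smul, hz, h4, smul_zero, smul_zero,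
      add_zero]
  · have heven : (β : E) ∈ R.evenRoots := by
      refine ⟨hβ, by simpa using hβ0, fun α hα => ?_⟩
      have he : Even (R.pairing β ⟨α, hα⟩) := by
        rw [← Int.not_odd_iff_even]
        exact fun ho => hodd ⟨_, ho⟩
      obtain ⟨m, hm⟩ := he
      exact ⟨m, by rw [R.pairing_spec β ⟨α, hα⟩, hm]; push_cast; ring⟩
    have hu := htwo (isTypeC_of_mem_evenRoots hred hirr heven)
    have hu4 : IsUnit (4 : k) := by
      have := hu.mul hu
      norm_num at this
      exact this
    rw [← Int.cast_smul_eq_zsmul k] at h4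
    push_cast at h4
    exact hu4.smul_eq_zero.1 h4

end Pairing

end LocallyFiniteRootSystem

/-! ### Lifting the grading action to the central covering. -/

section Covering

variable {𝕂 : Type u} {E : Type v} [Field 𝕂] [AddCommGroup E] [Module 𝕂 E]
  {R : LocallyFiniteRootSystem 𝕂 E} [DecidableEq R.rootLattice]
  {k : Type*} {L : Type*} {K : Type*} [CommRing k]
  [LieRing L] [LieAlgebra k L] [LieRing K] [LieAlgebra k K]
  {𝓛 : R.rootLattice → Submodule k L} [GradedLieAlgebra 𝓛]
  {𝓚 : R.rootLattice → Submodule k K} {f : K →ₗ⁅k⁆ L}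

theorem IsCentralCovering.lie_eq_zero (hf : IsCentralCovering f) {x : K} (hx : f x = 0) (y : K) :
    ⁅y, x⁆ = 0 :=
  (LieModule.mem_maxTrivSubmodule k K K x).1 (hf.ker_le_center (by simpa using hx)) y

theorem IsCentralCovering.lie_eq_zero' (hf : IsCentralCovering f) {x : K} (hx : f x = 0) (y : K) :
    ⁅x, y⁆ = 0 := by
  rw [← lie_skew, hf.lie_eq_zero hx, neg_zero]

theorem IsRootGraded.map_eq_zero (hL : IsRootGraded R 𝓛) (hgr : ∀ γ, ∀ x ∈ 𝓚 γ, f x ∈ 𝓛 γ)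
    {γ : R.rootLattice} (hγ : (γ : E) ∉ R.roots) {x : K} (hx : x ∈ 𝓚 γ) : f x = 0 := by
  have h := hgr γ x hx
  rwa [hL.eq_bot_of_notMem γ hγ, Submodule.mem_bot] at h

variable [CharZero 𝕂] [GradedLieAlgebra 𝓚]

/-- The elements `h_α` lift to elements of `K` which act on all homogeneous components by the
pairings with `α`. -/
theorem IsRootGraded.exists_lift (hL : IsRootGraded R 𝓛) (hf : IsCentralCovering f)
    (hgr : ∀ γ, ∀ x ∈ 𝓚 γ, f x ∈ 𝓛 γ) {α : R.rootLattice} (hα : (α : E) ∈ R.roots) (hα0 : α ≠ 0) :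
    ∃ e ∈ 𝓚 α, ∃ e' ∈ 𝓚 (-α), ∀ γ, ∀ x ∈ 𝓚 γ, ⁅⁅e', e⁆, x⁆ = R.pairing γ ⟨α, hα⟩ • x := by
  obtain ⟨e, he, e', he', h⟩ := hL.exists_invertible α hα hα0
  obtain ⟨e, hE, rfl⟩ := exists_mem_graded_map_eq 𝓛 𝓚 hf.surjective hgr he
  obtain ⟨e', hE', rfl⟩ := exists_mem_graded_map_eq 𝓛 𝓚 hf.surjective hgr he'
  refine ⟨e, hE, e', hE', fun γ => ?_⟩
  let M : Submodule k K := LinearMap.ker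
    (LieAlgebra.ad k K ⁅e', e⁆ - (R.pairing γ ⟨α, hα⟩ : k) • LinearMap.id)
  have hM : ∀ x, x ∈ M ↔ ⁅⁅e', e⁆, x⁆ = R.pairing γ ⟨α, hα⟩ • x := fun x => by
    simp [M, sub_eq_zero, Int.cast_smul_eq_zsmul]
  suffices 𝓚 γ ≤ M from fun x hx => (hM x).1 (this hx)
  -- On each factor of a bracket the lift acts by the expected scalar up to a central error, which
  -- the bracket removes; the Leibniz rule adds the scalars. A factor of non-root degree is itself
  -- central.
  refine graded_le_of_bracket_mem 𝓚 hf.perfect M fun β δ hβδ x hx y hy => (hM _).2 ?_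
  by_cases hβ : (β : E) ∈ R.roots
  · by_cases hδ : (δ : E) ∈ R.roots
    · have aux : ∀ (μ : R.rootLattice) (_ : (μ : E) ∈ R.roots) (u : K) (_ : u ∈ 𝓚 μ),
          f (⁅⁅e', e⁆, u⁆ - R.pairing μ ⟨α, hα⟩ • u) = 0 := by
        intro μ hμ u hu
        rw [map_sub, LieHom.map_lie, LieHom.map_lie, h μ hμ _ (hgr μ u hu), map_zsmul, sub_self]
      have h1 := hf.lie_eq_zero' (aux β hβ x hx) y
      have h2 := hf.lie_eq_zero (aux δ hδ y hy) x
      rw [sub_lie, sub_eq_zero, smul_lie] at h1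
      rw [lie_sub, sub_eq_zero, lie_smul] at h2
      rw [leibniz_lie ⁅e', e⁆, h1, h2, ← add_smul, ← R.pairing_add, hβδ]
    · rw [hf.lie_eq_zero (hL.map_eq_zero hgr hδ hy), lie_zero, smul_zero]
  · rw [hf.lie_eq_zero' (hL.map_eq_zero hgr hβ hx), lie_zero, smul_zero]

/-- The lifted `h_α` multiplies `z` by the pairing, yet annihilates it because `z` is central. -/
theorem IsRootGraded.pairing_smul_eq_zero (hL : IsRootGraded R 𝓛) (hf : IsCentralCovering f)
    (hgr : ∀ γ, ∀ x ∈ 𝓚 γ, f x ∈ 𝓛 γ) {γ : R.rootLattice} {z : K} (hz : z ∈ 𝓚 γ) (hfz : f z = 0)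
    (α : R.roots) : R.pairing γ α • z = 0 := by
  obtain ⟨α, hα⟩ := α
  by_cases hα0 : α = 0
  · subst hα0
    rw [R.pairing_zero_right, zero_smul]
  · obtain ⟨e, -, e', -, h⟩ := hL.exists_lift hf hgr
      (α := ⟨α, AddSubgroup.subset_closure hα⟩) hα (by simpa [Subtype.ext_iff] using hα0)
    rw [← h γ z hz, hf.lie_eq_zero hfz]

/-- If `2β` is not a sum of two linearly independent roots, then the odd pairings of `β` kill
`[K_β, K_β]`. -/
theorem IsRootGraded.odd_pairing_smul_lie (hL : IsRootGraded R 𝓛) (hf : IsCentralCovering f)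
    (hgr : ∀ γ, ∀ x ∈ 𝓚 γ, f x ∈ 𝓛 γ) (hred : R.IsReduced) {β : R.rootLattice}
    (hβ : (β : E) ∈ R.roots) (hβ0 : β ≠ 0)
    (hnd : ¬ ∃ α ∈ R.roots, ∃ δ ∈ R.roots, LinearIndependent 𝕂 ![α, δ] ∧ (β : E) + β = α + δ)
    {x y : K} (hx : x ∈ 𝓚 β) (hy : y ∈ 𝓚 β) (α : R.roots) (hodd : Odd (R.pairing β α)) :
    R.pairing β α • ⁅x, y⁆ = 0 := by
  have hvan : ∀ (μ ν : R.rootLattice) (u v : K), u ∈ 𝓚 μ → v ∈ 𝓚 ν →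
      LinearIndependent 𝕂 ![(μ : E), (ν : E)] → (β : E) + β = μ + ν → ⁅u, v⁆ = 0 := by
    intro μ ν u v hu hv hli h
    by_cases hμ : (μ : E) ∈ R.roots
    · by_cases hν : (ν : E) ∈ R.roots
      · exact absurd ⟨μ, hμ, ν, hν, hli, h⟩ hnd
      · exact hf.lie_eq_zero (hL.map_eq_zero hgr hν hv) u
    · exact hf.lie_eq_zero' (hL.map_eq_zero hgr hμ hu) v
  obtain ⟨α, hα⟩ := α
  have hβE : (β : E) ≠ 0 := by simpa using hβ0
  have hα0 : α ≠ 0 := by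
    rintro rfl
    rw [R.pairing_zero_right] at hodd
    exact absurd hodd (by decide)
  -- A root `α = ±β` would give the even pairing `±2`.
  have hli : LinearIndependent 𝕂 ![(β : E), α] := by
    by_contra hli
    rcases hred.eq_or_eq_neg hβ hβE hα hα0 hli with rfl | rfl
    · rw [R.pairing_self hα hβ0] at hodd
      exact absurd hodd (by decide)
    · have h2 : R.coroot (-(β : E)) β = (-2 : ℤ) := by
        have h := R.coroot_self _ hα hα0
        rw [map_neg] at h
        push_cast
        linear_combination -h
      rw [R.pairing_eq_of_coroot_eq h2] at hodd
      exact absurd hodd (by decide)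
  rw [LinearIndependent.pair_iff] at hli
  obtain ⟨α, rfl⟩ : ∃ α' : R.rootLattice, (α' : E) = α := ⟨⟨α, AddSubgroup.subset_closure hα⟩, rfl⟩
  obtain ⟨e, he, e', he', h⟩ := hL.exists_lift hf hgr hα (by simpa using hα0)
  -- By Jacobi the double bracket splits into brackets of degrees `μ, 2β - μ` and `β - μ, β + μ`.
  -- Each pair is independent with sum `2β`, so both terms vanish by `hvan`.
  have key : ∀ (c : 𝕂) (_ : c ≠ 0) (μ : R.rootLattice) (_ : (μ : E) = c • (α : E)) (u v : K),
      u ∈ 𝓚 μ → v ∈ 𝓚 (-μ) → ⁅⁅u, ⁅v, x⁆⁆, y⁆ = 0 := by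
    intro c hc μ hμ u v hu hv
    have hvx := SetLike.GradedBracket.bracket_mem hv hx
    have huy := SetLike.GradedBracket.bracket_mem hu hy
    rw [lie_lie, hvan _ _ ⁅v, x⁆ ⁅u, y⁆ hvx huy ?_ ?_,
      hvan _ _ u ⁅⁅v, x⁆, y⁆ hu (SetLike.GradedBracket.bracket_mem hvx hy) ?_ ?_, sub_zero]
    · rw [LinearIndependent.pair_iff]
      intro s t hst
      simp only [AddSubgroup.coe_add, AddSubgroup.coe_neg, hμ] at hst
      obtain ⟨h1, h2⟩ := hli (2 * t) ((s - t) * c) (by rw [← hst]; module)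
      have ht : t = 0 := by simpa using h1
      have hs : s - t = 0 := (mul_eq_zero.1 h2).resolve_right hc
      exact ⟨by rwa [ht, sub_zero] at hs, ht⟩
    · simp only [AddSubgroup.coe_add, AddSubgroup.coe_neg]
      abel
    · rw [LinearIndependent.pair_iff]
      intro s t hst
      simp only [AddSubgroup.coe_add, AddSubgroup.coe_neg, hμ] at hst
      obtain ⟨h1, h2⟩ := hli (s + t) ((t - s) * c) (by rw [← hst]; module)
      have hs : t - s = 0 := (mul_eq_zero.1 h2).resolve_right hc
      have ht : t = s := sub_eq_zero.1 hs
      have hs0 : s = 0 := by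
        rw [ht, ← two_mul] at h1
        simpa using h1
      exact ⟨hs0, ht.trans hs0⟩
    · simp only [AddSubgroup.coe_add, AddSubgroup.coe_neg]
      abel
  -- Writing `⟨β, α∨⟩ x` as `[e', [e, x]] - [e, [e', x]]` reduces the claim to `key` for `μ = -α`
  -- and `μ = α`.
  rw [← smul_lie, ← h β x hx, lie_lie e' e x, sub_lie,
    key (-1) (by simp) (-α) (by simp) e' e he' (by rwa [neg_neg]),
    key 1 one_ne_zero α (by simp) e e' he he', sub_zero]

end Covering

theorem mainTheorem1 {𝕂 : Type*} {E : Type*} [Field 𝕂] [CharZero 𝕂] [AddCommGroup E] [Module 𝕂 E]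
    (R : LocallyFiniteRootSystem 𝕂 E) [DecidableEq R.rootLattice]
    (hred : R.IsReduced) (hirr : R.IsIrreducible)
    {k : Type*} {L : Type*} {K : Type*} [CommRing k]
    [LieRing L] [LieAlgebra k L] [LieRing K] [LieAlgebra k K]
    (htwo : R.IsTypeC → IsUnit (2 : k))
    (𝓛 : R.rootLattice → Submodule k L) [GradedLieAlgebra 𝓛] (hL : IsRootGraded R 𝓛)
    (𝓚 : R.rootLattice → Submodule k K) [GradedLieAlgebra 𝓚]
    (f : K →ₗ⁅k⁆ L) (hf : IsCentralCovering f) (hgr : ∀ γ, ∀ x ∈ 𝓚 γ, f x ∈ 𝓛 γ)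
    (γ : R.rootLattice) (hγ : γ ≠ 0) (hsupp : 𝓚 γ ≠ ⊥) :
    ((γ : E) ∈ R.roots ∧ Set.BijOn f (𝓚 γ) (𝓛 γ)) ∨
    ((γ : E) ∉ R.roots ∧ R.IsDegenerateSum γ ∧ (∀ x ∈ 𝓚 γ, x ∈ f.ker) ∧
      (R.divisor γ = 2 ∨ R.divisor γ = 3) ∧ ∀ x ∈ 𝓚 γ, R.divisor γ • x = 0) := by
  by_cases hγR : (γ : E) ∈ R.roots
  · refine .inl ⟨hγR, fun x hx => hgr γ x hx, fun x hx y hy hxy => ?_, fun y hy =>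
      exists_mem_graded_map_eq 𝓛 𝓚 hf.surjective hgr hy⟩
    have hz : x - y ∈ 𝓚 γ := (𝓚 γ).sub_mem hx hy
    have hp := hL.pairing_smul_eq_zero hf hgr hz (by rw [map_sub, hxy, sub_self])
    have h2 := hp ⟨γ, hγR⟩
    rw [R.pairing_self hγR hγ] at h2
    refine sub_eq_zero.1 (R.eq_zero_of_odd_pairing_smul hred hirr htwo hγR hγ ?_ fun α _ => hp α)
    rw [show (4 : ℤ) = 2 * 2 by norm_num, mul_smul, h2, smul_zero]
  · have hker : ∀ x ∈ 𝓚 γ, f x = 0 := fun x hx => hL.map_eq_zero hgr hγR hx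
    have hdec : ∃ α ∈ R.roots, ∃ β ∈ R.roots, LinearIndependent 𝕂 ![α, β] ∧ (γ : E) = α + β := by
      by_contra hnd
      refine hsupp (eq_bot_iff.2 (graded_le_of_bracket_mem 𝓚 hf.perfect ⊥ ?_))
      intro β δ hβδ x hx y hy
      rw [Submodule.mem_bot]
      by_cases hβ : (β : E) ∈ R.roots
      · by_cases hδ : (δ : E) ∈ R.roots
        · have hsum : (γ : E) = β + δ := by rw [← hβδ, AddSubgroup.coe_add]
          have hβ0 : (β : E) ≠ 0 := fun h => hγR (by rwa [hsum, h, zero_add])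
          have hδ0 : (δ : E) ≠ 0 := fun h => hγR (by rwa [hsum, h, add_zero])
          have hli : ¬ LinearIndependent 𝕂 ![(β : E), (δ : E)] := fun hli =>
            hnd ⟨β, hβ, δ, hδ, hli, hsum⟩
          have hβ0' : β ≠ 0 := by simpa using hβ0
          rcases hred.eq_or_eq_neg hβ hβ0 hδ hδ0 hli with h | h
          · obtain rfl : δ = β := Subtype.ext h
            rw [hsum] at hnd
            have hxy : ⁅x, y⁆ ∈ 𝓚 γ := hβδ ▸ SetLike.GradedBracket.bracket_mem hx hy
            -- Now `γ = 2β`, and `⟨2β, β∨⟩ = 4` kills the bracket.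
            have h4 := hL.pairing_smul_eq_zero hf hgr hxy (hker _ hxy) ⟨δ, hβ⟩
            rw [← hβδ, R.pairing_add, R.pairing_self hβ hβ0'] at h4
            exact R.eq_zero_of_odd_pairing_smul hred hirr htwo hβ hβ0' h4
              (hL.odd_pairing_smul_lie hf hgr hred hβ hβ0' hnd hx hy)
          · refine absurd (Subtype.ext ?_) hγ
            rw [hsum, h, add_neg_cancel, AddSubgroup.coe_zero]
        · exact hf.lie_eq_zero (hL.map_eq_zero hgr hδ hy) x
      · exact hf.lie_eq_zero' (hL.map_eq_zero hgr hβ hx) y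
    obtain ⟨α, hα, β, hβ, hli, hsum⟩ := hdec
    obtain ⟨⟨δ, hδ⟩, hdiv⟩ := R.divisor_of_linearIndependent hα hβ hli hsum
    have hann : ∀ x ∈ 𝓚 γ, R.divisor γ • x = 0 := fun x hx =>
      R.divisor_smul_eq_zero hδ (hL.pairing_smul_eq_zero hf hgr hx (hker x hx))
    have hne : R.divisor γ ≠ 1 := fun h1 => hsupp (eq_bot_iff.2 fun x hx => by
      simpa [h1] using hann x hx)
    have hdiv := hdiv.resolve_left hne
    exact .inr ⟨hγR, ⟨⟨α, hα, β, hβ, hli, hsum⟩, by omega⟩,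
      fun x hx => by simpa using hker x hx, hdiv, hann⟩
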